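/- Let $E$ be a real Banach space such that $\ell_\infty$ is finitely representable in the dual space $E^*$; that is, for every finite-dimensional subspace $F\subset\ell_\infty$ and every $\varepsilon>0$ there is a linear map $T:F\to E^*$ with $\|y\|\le\|Ty\|\le(1+\varepsilon)\|y\|$ for all $y\in F$. Let $(e_n)\subset c_0\subset\ell_\infty$ be the canonical basis of $c_0$. Then for every sequence $(a_n)_{n\in\mathbb N}$ of positive reals the following three conditions are equivalent: (i) $(a_n)$ is $(w^*,E^*)$-acceptable, i.e. there is a sequence $(x_n^*)\subset E^*$ with $\|x_n^*\|=a_n$ for all $n$, for which $0$ is a cluster point in the weak-star topology $\sigma(E^*,E)$; (ii) the sequence $(a_ne_n)$ has $0$ as a cluster point in the topology $\sigma(\ell_\infty,\ell_1)$; (iii) $\sum_{n=1}^\infty a_n^{-1}=\infty$. Here $z$ is a cluster point of a sequence $(u_n)$ if every neighbourhood of $z$ contains $u_n$ for infinitely many $n$. -/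

import Mathlib

open Filter Topology
open scoped ENNReal lp

/-- A normed space `Y` is finitely representable in a normed space `X`: for every finite-dimensional
subspace `F` of `Y` and every `ε > 0` there is a `(1 + ε)`-isomorphic (linear) embedding of `F`
into `X`. -/
def FinitelyRepresentable (Y X : Type*) [NormedAddCommGroup Y] [NormedSpace ℝ Y]
    [NormedAddCommGroup X] [NormedSpace ℝ X] : Prop :=
  ∀ F : Submodule ℝ Y, FiniteDimensional ℝ F → ∀ ε : ℝ, 0 < ε →
    ∃ T : F →ₗ[ℝ] X, ∀ y : F, ‖y‖ ≤ ‖T y‖ ∧ ‖T y‖ ≤ (1 + ε) * ‖y‖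

/-- The real Banach space `ℓ_∞` of bounded real sequences, with the supremum norm. -/
abbrev EllInfty : Type := lp (fun _ : ℕ => ℝ) ∞

/-- The real Banach space `ℓ_1` of absolutely summable real sequences. -/
abbrev EllOne : Type := lp (fun _ : ℕ => ℝ) 1

/-- A sequence `(a_n)` of (positive) reals is `(w*, E*)`-acceptable: there are functionals
`x_n ∈ E*` with `‖x_n‖ = a_n` such that `0` is a cluster point of the sequence `(x_n)` in the
weak-star topology `σ(E*, E)`. -/
def WeakStarAcceptable (E : Type*) [NormedAddCommGroup E] [NormedSpace ℝ E] (a : ℕ → ℝ) : Prop :=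
  ∃ x : ℕ → StrongDual ℝ E, (∀ n, ‖x n‖ = a n) ∧
    MapClusterPt (0 : WeakDual ℝ E) atTop (fun n => StrongDual.toWeakDual (x n))

theorem summable_ellInfty_mul_ellOne (x : EllInfty) (y : EllOne) :
    Summable fun n => x n * y n := by
  have hy : Summable fun n => ‖y n‖ := by
    simpa using (lp.memℓp y).summable (by norm_num)
  refine Summable.of_norm_bounded (hy.mul_left ‖x‖) fun n => ?_
  rw [norm_mul]
  exact mul_le_mul_of_nonneg_right (lp.norm_apply_le_norm ENNReal.top_ne_zero x n) (norm_nonneg _)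

/-- The canonical duality between `ℓ_∞` and `ℓ_1`: `⟨x, y⟩ = ∑ x_n y_n`. -/
noncomputable def ellPairing : EllInfty →ₗ[ℝ] EllOne →ₗ[ℝ] ℝ :=
  LinearMap.mk₂ ℝ (fun x y => ∑' n, x n * y n)
    (fun x x' y => by
      rw [← (summable_ellInfty_mul_ellOne x y).tsum_add (summable_ellInfty_mul_ellOne x' y)]
      exact tsum_congr fun n => by simp [add_mul])
    (fun c x y => by
      rw [smul_eq_mul, ← tsum_mul_left]
      exact tsum_congr fun n => by simp [mul_assoc])
    (fun x y y' => by
      rw [← (summable_ellInfty_mul_ellOne x y).tsum_add (summable_ellInfty_mul_ellOne x y')]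
      exact tsum_congr fun n => by simp [mul_add])
    (fun c x y => by
      rw [smul_eq_mul, ← tsum_mul_left]
      exact tsum_congr fun n => by simp [mul_left_comm])

/-- The canonical basis vector `e_n` of `c_0`, as an element of `ℓ_∞`. -/
noncomputable def ellBasis (n : ℕ) : EllInfty := lp.single ∞ n (1 : ℝ)

/-- The space `ℓ_∞` with the topology `σ(ℓ_∞, ℓ_1)`, the coarsest topology making all the maps
`x ↦ ⟨x, y⟩`, `y ∈ ℓ_1`, continuous. -/
abbrev EllInftyWeak : Type := WeakBilin ellPairing

/-- The identity map from `ℓ_∞` to `ℓ_∞` with the topology `σ(ℓ_∞, ℓ_1)`. -/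
noncomputable def toEllInftyWeak : EllInfty ≃ₗ[ℝ] EllInftyWeak := LinearEquiv.refl ℝ EllInfty

/-! The hard implication is (i) ⇒ (iii): if `∑ ‖f n‖⁻¹ < ∞`, there are two vectors `x`, `y` with `|f
n x| + |f n y| ≥ δ` for all `n`, so a weak-star neighbourhood of `0` misses the whole sequence. This
is a weak plank theorem on the complexification `E × E`. Weights `v n` that are still summable are
chosen so that points `p n` with `f n (p n) = (v n)⁻¹` tend to `0`; the rotations `ζ p n` then have
a compact absolutely convex hull. A maximizer `z` of `∏ ‖g k z‖ ^ v k` on this hull is moved towards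
`ζ p i` and the logarithm is averaged over `‖ζ‖ = 1`. By the sub-mean-value inequality no factor
loses on average, so maximality keeps `‖g i z‖` from being small
(`exists_forall_exp_neg_le_norm_finset`). For (iii) ⇒ (i), copies of the `e_n` in `E*` are used on
successive blocks whose sums of `(a n)⁻¹` grow without bound. (ii) ⇔ (iii) is tested against the
`ℓ_1` sequence `(a n)⁻¹`. -/

/-! ### A weak complex plank theorem. -/

/-- The circle average of `log ‖A + ζ B‖` dominates both `log ‖A‖` and `log ‖B‖`. -/
theorem log_norm_le_circleAverage {A B : ℂ} (hA : A ≠ 0) (hAB : ‖A‖ ≠ ‖B‖) :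
    Real.log ‖A‖ ≤ Real.circleAverage (fun ζ => Real.log ‖A + ζ * B‖) 0 1 ∧
    (B ≠ 0 → Real.log ‖B‖ ≤ Real.circleAverage (fun ζ => Real.log ‖A + ζ * B‖) 0 1) := by
  rcases eq_or_ne B 0 with rfl | hB
  · simp [Real.circleAverage_const]
  -- Jensen's formula for a linear polynomial. Since `‖A‖ ≠ ‖B‖`, there is no zero on the circle,
  -- where `Real.log 0 = 0` would spoil the pointwise factorization.
  have h : Real.circleAverage (fun ζ => Real.log ‖A + ζ * B‖) 0 1
      = Real.log ‖B‖ + Real.posLog ‖A / B‖ := by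
    rw [← circleAverage_log_norm_add_const_eq_posLog,
      ← Real.circleAverage_const (Real.log ‖B‖) 0 1, ← Real.circleAverage_fun_add
        (circleIntegrable_const _ _ _)
        (MeromorphicOn.circleIntegrable_log_norm (fun _ _ => by fun_prop))]
    refine Real.circleAverage_congr_sphere fun ζ hζ => ?_
    have hζ1 : ‖ζ‖ = 1 := by simpa using hζ
    have hne : ζ + A / B ≠ 0 := by
      intro h0
      apply hAB
      have : A = -(ζ * B) := by
        field_simp at h0
        linear_combination h0
      rw [this, norm_neg, norm_mul, hζ1, one_mul]
    show Real.log ‖A + ζ * B‖ = Real.log ‖B‖ + Real.log ‖ζ + A / B‖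
    rw [← Real.log_mul (norm_ne_zero_iff.2 hB) (norm_ne_zero_iff.2 hne), ← norm_mul]
    congr 2
    field_simp
    ring
  rw [h]
  refine ⟨?_, fun _ => le_add_of_nonneg_right Real.posLog_nonneg⟩
  have h1 : Real.log ‖A / B‖ ≤ Real.posLog ‖A / B‖ := le_max_right _ _
  rw [norm_div, Real.log_div (norm_ne_zero_iff.2 hA) (norm_ne_zero_iff.2 hB)] at h1
  rw [norm_div]
  linarith

/-- A convex set which for each of finitely many functionals contains a point outside its kernel
contains a point outside all the kernels. -/
theorem Convex.exists_forall_apply_ne_zero {F ι : Type*} [NormedAddCommGroup F] [NormedSpace ℝ F]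
    {K : Set F} (hK : Convex ℝ K) (hne : K.Nonempty) (g : ι → F →L[ℝ] ℂ) (s : Finset ι)
    (h : ∀ k ∈ s, ∃ q ∈ K, g k q ≠ 0) : ∃ z ∈ K, ∀ k ∈ s, g k z ≠ 0 := by
  classical
  induction s using Finset.induction_on with
  | empty => exact ⟨hne.some, hne.some_mem, by simp⟩
  | insert a s _ ih =>
    obtain ⟨z, hz, hzs⟩ := ih fun k hk => h k (Finset.mem_insert_of_mem hk)
    by_cases ha : g a z = 0
    · obtain ⟨q, hq, hqa⟩ := h a (Finset.mem_insert_self a s)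
      -- A small move from `z` towards `q` preserves the finitely many nonvanishing conditions and
      -- gives `g a` the value `τ * g a q`.
      have hc : ∀ k ∈ s, ∀ᶠ τ : ℝ in 𝓝[>] 0, g k ((1 - τ) • z + τ • q) ≠ 0 := by
        intro k hk
        have hcont : Continuous fun τ : ℝ => g k ((1 - τ) • z + τ • q) := by fun_prop
        have := hcont.tendsto 0
        simp only [sub_zero, one_smul, zero_smul, add_zero] at this
        exact (this.mono_left nhdsWithin_le_nhds).eventually_ne (hzs k hk)
      have hall := (Filter.eventually_all_finset s).2 hc
      have hlt : ∀ᶠ τ : ℝ in 𝓝[>] 0, τ ∈ Set.Ioo (0 : ℝ) 1 := Ioo_mem_nhdsGT one_pos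
      obtain ⟨τ, hτ, hτ0, hτ1⟩ := (hall.and hlt).exists
      refine ⟨(1 - τ) • z + τ • q, hK hz hq (by linarith) hτ0.le (by ring), fun k hk => ?_⟩
      rcases Finset.mem_insert.1 hk with rfl | hk
      · simp [ha, hqa, hτ0.ne']
      · exact hτ k hk
    · refine ⟨z, hz, fun k hk => ?_⟩
      rcases Finset.mem_insert.1 hk with rfl | hk
      · exact ha
      · exact hzs k hk

/-- A weak complex plank theorem for finitely many functionals, obtained by maximizing
`∏ ‖g k z‖ ^ v k` over `K`. -/
theorem exists_forall_exp_neg_le_norm_finset {F ι : Type*} [NormedAddCommGroup F]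
    [NormedSpace ℝ F] {K : Set F} (hK : Convex ℝ K) (hcomp : IsCompact K) (hne : K.Nonempty)
    (g : ι → F →L[ℝ] ℂ) (R : ι → ℂ → F) (c : ι → ι → ℂ) (v : ι → ℝ) (V : ℝ)
    (hv : ∀ k, 0 < v k) (hR : ∀ k ζ, ‖ζ‖ = 1 → R k ζ ∈ K)
    (hgR : ∀ j k ζ, g j (R k ζ) = ζ * c j k) (hc : ∀ k, c k k = ((v k)⁻¹ : ℝ))
    (s : Finset ι) (hV : ∑ k ∈ s, v k ≤ V) :
    ∃ z ∈ K, ∀ k ∈ s, Real.exp (-V) / 2 ≤ ‖g k z‖ := by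
  classical
  obtain ⟨z₀, hz₀, hz₀s⟩ := hK.exists_forall_apply_ne_zero hne g s fun k _ =>
    ⟨R k 1, hR k 1 (by simp), by simp [hgR, hc, (hv k).ne']⟩
  have hcont : Continuous fun z => ∏ k ∈ s, ‖g k z‖ ^ v k :=
    continuous_finsetProd _ fun k _ =>
      ((g k).continuous.norm).rpow_const fun _ => Or.inr (hv k).le
  obtain ⟨z, hz, hmax⟩ := hcomp.exists_isMaxOn hne hcont.continuousOn
  have hpos : 0 < ∏ k ∈ s, ‖g k z‖ ^ v k :=
    lt_of_lt_of_le (Finset.prod_pos fun k hk =>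
      Real.rpow_pos_of_pos (norm_pos_iff.2 (hz₀s k hk)) _) (hmax hz₀)
  have hgz : ∀ k ∈ s, g k z ≠ 0 := by
    intro k hk h0
    rw [Finset.prod_eq_zero hk (by simp [h0, (hv k).ne'])] at hpos
    exact lt_irrefl _ hpos
  have hlog : ∀ y ∈ K, (∀ k ∈ s, g k y ≠ 0) →
      ∑ k ∈ s, v k * Real.log ‖g k y‖ ≤ ∑ k ∈ s, v k * Real.log ‖g k z‖ := by
    intro y hy hgy
    have key : ∀ x, (∀ k ∈ s, g k x ≠ 0) →
        Real.log (∏ k ∈ s, ‖g k x‖ ^ v k) = ∑ k ∈ s, v k * Real.log ‖g k x‖ := by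
      intro x hx
      rw [Real.log_prod fun k hk => (Real.rpow_pos_of_pos (norm_pos_iff.2 (hx k hk)) _).ne']
      exact Finset.sum_congr rfl fun k hk => Real.log_rpow (norm_pos_iff.2 (hx k hk)) _
    rw [← key y hgy, ← key z hgz]
    exact Real.log_le_log (Finset.prod_pos fun k hk =>
      Real.rpow_pos_of_pos (norm_pos_iff.2 (hgy k hk)) _) (hmax hy)
  refine ⟨z, hz, fun i hi => ?_⟩
  -- The step size is comparable to `v i`, so that `‖t * c i i‖` lies between `1 / 2` and `1`; the
  -- finitely many excluded values would put a zero of some `g k z + ζ t c k i` on the unit circle.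
  obtain ⟨t, ⟨ht1, ht2⟩, htne⟩ : ∃ t ∈ Set.Ioo (v i / 2) (v i),
      t ∉ s.image fun k => ‖g k z‖ / ‖c k i‖ :=
    (Set.Ioo_infinite (by linarith [hv i])).exists_notMem_finset _
  have ht0 : 0 < t := by linarith [hv i]
  have hAB : ∀ k ∈ s, ‖g k z‖ ≠ ‖(t : ℂ) * c k i‖ := by
    intro k hk h
    have hck : ‖c k i‖ ≠ 0 := by
      intro h0
      rw [norm_mul, h0, mul_zero] at h
      exact hgz k hk (norm_eq_zero.1 h)
    refine htne (Finset.mem_image.2 ⟨k, hk, ?_⟩)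
    rw [h, norm_mul, Complex.norm_real, Real.norm_of_nonneg ht0.le]
    field_simp
  have hint : ∀ k, CircleIntegrable
      (fun ζ => Real.log ‖g k z + ζ * ((t : ℂ) * c k i)‖) 0 1 := fun k =>
    MeromorphicOn.circleIntegrable_log_norm fun _ _ => by fun_prop
  have hintv : ∀ k, CircleIntegrable
      (fun ζ => v k * Real.log ‖g k z + ζ * ((t : ℂ) * c k i)‖) 0 1 := fun k =>
    (hint k).const_smul (a := v k)
  have hsv : 0 ≤ ∑ k ∈ s, v k := Finset.sum_nonneg fun k _ => (hv k).le
  -- Maximality of `z` against the points `(z + t R i ζ) / (1 + t)` of `K`; the normalization costs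
  -- at most `V * t`.
  have hupper : Real.circleAverage
      (fun ζ => ∑ k ∈ s, v k * Real.log ‖g k z + ζ * ((t : ℂ) * c k i)‖) 0 1
      ≤ ∑ k ∈ s, v k * Real.log ‖g k z‖ + V * t := by
    refine Real.circleAverage_mono_on_of_le_circle
      (CircleIntegrable.fun_sum s fun k _ => hintv k) fun ζ hζ => ?_
    have hζ1 : ‖ζ‖ = 1 := by simpa using hζ
    have hne' : ∀ k ∈ s, g k z + ζ * ((t : ℂ) * c k i) ≠ 0 := by
      intro k hk h0
      apply hAB k hk
      rw [eq_neg_of_add_eq_zero_left h0, norm_neg, norm_mul, hζ1, one_mul]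
    set y : F := (1 + t)⁻¹ • z + (t * (1 + t)⁻¹) • R i ζ with hy
    have hyK : y ∈ K := hK hz (hR i ζ hζ1) (by positivity) (by positivity) (by field_simp)
    have hgy : ∀ k, g k y = ((1 + t)⁻¹ : ℝ) * (g k z + ζ * ((t : ℂ) * c k i)) := by
      intro k
      simp only [hy, map_add, map_smul, hgR, Complex.real_smul]
      push_cast
      ring
    have h1t : (1 + t)⁻¹ ≠ 0 := by positivity
    have hgy0 : ∀ k ∈ s, g k y ≠ 0 := by
      intro k hk
      rw [hgy]
      exact mul_ne_zero (Complex.ofReal_ne_zero.2 h1t) (hne' k hk)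
    have hle := hlog y hyK hgy0
    have hsum : ∑ k ∈ s, v k * Real.log ‖g k y‖ =
        ∑ k ∈ s, v k * Real.log ‖g k z + ζ * ((t : ℂ) * c k i)‖
          - (∑ k ∈ s, v k) * Real.log (1 + t) := by
      rw [Finset.sum_mul, ← Finset.sum_sub_distrib]
      refine Finset.sum_congr rfl fun k hk => ?_
      rw [hgy, norm_mul, Complex.norm_real, Real.norm_of_nonneg (by positivity),
        Real.log_mul h1t (norm_ne_zero_iff.2 (hne' k hk)), Real.log_inv]
      ring
    have hlogt : Real.log (1 + t) ≤ t := by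
      have := Real.log_le_sub_one_of_pos (show 0 < 1 + t by positivity)
      linarith
    have : (∑ k ∈ s, v k) * Real.log (1 + t) ≤ V * t :=
      mul_le_mul hV hlogt (Real.log_nonneg (by linarith)) (hsv.trans hV)
    linarith
  -- The average is bounded below by `log ‖A‖` for `k ≠ i` and by `log ‖B‖` for `k = i`; the terms
  -- `k ≠ i` then cancel against `hupper`.
  have hlower : ∑ k ∈ s.erase i, v k * Real.log ‖g k z‖ + v i * Real.log (t / v i) ≤
      Real.circleAverage
        (fun ζ => ∑ k ∈ s, v k * Real.log ‖g k z + ζ * ((t : ℂ) * c k i)‖) 0 1 := by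
    rw [Real.circleAverage_fun_sum fun k _ => hintv k, ← Finset.sum_erase_add s _ hi]
    have hsm : ∀ k, Real.circleAverage
        (fun ζ => v k * Real.log ‖g k z + ζ * ((t : ℂ) * c k i)‖) 0 1 =
        v k * Real.circleAverage (fun ζ => Real.log ‖g k z + ζ * ((t : ℂ) * c k i)‖) 0 1 :=
      fun k => Real.circleAverage_fun_smul (a := v k)
    refine add_le_add (Finset.sum_le_sum fun k hk => ?_) ?_
    · rw [hsm]
      have hk := Finset.mem_of_mem_erase hk
      refine mul_le_mul_of_nonneg_left ?_ (hv k).le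
      exact (log_norm_le_circleAverage (hgz k hk) (hAB k hk)).1
    · rw [hsm]
      refine mul_le_mul_of_nonneg_left ?_ (hv i).le
      have hti : ‖(t : ℂ) * c i i‖ = t / v i := by
        rw [hc, norm_mul, Complex.norm_real, Complex.norm_real, Real.norm_of_nonneg ht0.le,
          Real.norm_of_nonneg (inv_nonneg.2 (hv i).le), div_eq_mul_inv]
      rw [← hti]
      refine (log_norm_le_circleAverage (hgz i hi) (hAB i hi)).2 (norm_pos_iff.1 ?_)
      rw [hti]
      exact div_pos ht0 (hv i)
  have hfin : v i * Real.log (t / v i) ≤ v i * Real.log ‖g i z‖ + V * t := by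
    rw [← Finset.sum_erase_add s (fun k => v k * Real.log ‖g k z‖) hi] at hupper
    linarith
  have hVt : V * t ≤ v i * V := by
    rw [mul_comm]
    exact mul_le_mul_of_nonneg_right ht2.le (hsv.trans hV)
  have hfin' : Real.log (t / v i) - V ≤ Real.log ‖g i z‖ := by
    refine le_of_mul_le_mul_left ?_ (hv i)
    linarith
  have hgi := norm_pos_iff.2 (hgz i hi)
  have hhalf : 1 / 2 ≤ t / v i := by
    rw [le_div_iff₀ (hv i)]
    linarith
  calc Real.exp (-V) / 2 ≤ t / v i * Real.exp (-V) := by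
        nlinarith [Real.exp_pos (-V)]
    _ = Real.exp (Real.log (t / v i) - V) := by
        rw [sub_eq_add_neg, Real.exp_add, Real.exp_log (div_pos ht0 (hv i))]
    _ ≤ ‖g i z‖ := by
        exact (Real.exp_le_exp.2 hfin').trans (Real.exp_log hgi).le

/-- The weak complex plank theorem for a sequence of functionals on a compact convex set. -/
theorem exists_forall_exp_neg_le_norm {F : Type*} [NormedAddCommGroup F]
    [NormedSpace ℝ F] {K : Set F} (hK : Convex ℝ K) (hcomp : IsCompact K) (hne : K.Nonempty)
    (g : ℕ → F →L[ℝ] ℂ) (R : ℕ → ℂ → F) (c : ℕ → ℕ → ℂ) (v : ℕ → ℝ)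
    (hv : ∀ k, 0 < v k) (hsum : Summable v) (hR : ∀ k ζ, ‖ζ‖ = 1 → R k ζ ∈ K)
    (hgR : ∀ j k ζ, g j (R k ζ) = ζ * c j k) (hc : ∀ k, c k k = ((v k)⁻¹ : ℝ)) :
    ∃ z ∈ K, ∀ k, Real.exp (-∑' k, v k) / 2 ≤ ‖g k z‖ := by
  have hclosed : ∀ n, IsClosed {z | ∀ k ∈ Finset.range n,
      Real.exp (-∑' k, v k) / 2 ≤ ‖g k z‖} := fun n => by
    simp only [Set.ofPred_forall]
    exact isClosed_biInter fun k _ => isClosed_le continuous_const (g k).continuous.norm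
  -- The bound with `V = ∑' k, v k` does not depend on the finite set, so the solution sets form a
  -- decreasing sequence of nonempty compact sets.
  obtain ⟨z, hz⟩ := IsCompact.nonempty_iInter_of_sequence_nonempty_isCompact_isClosed
    (fun n => K ∩ {z | ∀ k ∈ Finset.range n, Real.exp (-∑' k, v k) / 2 ≤ ‖g k z‖})
    (fun n z hz => ⟨hz.1, fun k hk => hz.2 k (Finset.range_mono n.le_succ hk)⟩)
    (fun n => exists_forall_exp_neg_le_norm_finset hK hcomp hne g R c v _ hv hR hgR hc _
      (hsum.sum_le_tsum _ fun k _ => (hv k).le))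
    (hcomp.inter_right (hclosed 0)) (fun n => hcomp.isClosed.inter (hclosed n))
  rw [Set.mem_iInter] at hz
  exact ⟨z, (hz 0).1, fun k => (hz (k + 1)).2 k (Finset.self_mem_range_succ k)⟩

/-! ### Slowly growing weights for a convergent series. -/

/-- A summable series of positive terms stays summable after multiplication with a suitable
sequence tending to infinity. -/
theorem Summable.exists_tendsto_atTop_mul {w : ℕ → ℝ} (hw : ∀ n, 0 < w n) (hs : Summable w) :
    ∃ b : ℕ → ℝ, (∀ n, 0 < b n) ∧ Tendsto b atTop atTop ∧ Summable fun n => b n * w n := by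
  set r : ℕ → ℝ := fun n => ∑' k, w (k + n) with hr
  have hsn : ∀ n, Summable fun k => w (k + n) := fun n => (summable_nat_add_iff n).2 hs
  have hrpos : ∀ n, 0 < r n := fun n => (hsn n).tsum_pos (fun k => (hw _).le) 0 (hw _)
  have hrec : ∀ n, r n = w n + r (n + 1) := by
    intro n
    simp only [hr]
    rw [(hsn n).tsum_eq_zero_add]
    simp only [zero_add]
    congr 1
    exact tsum_congr fun k => by congr 1; ring
  have hr0 : Tendsto r atTop (𝓝 0) := tendsto_sum_nat_add w
  have hsq : Tendsto (fun n => √(r n)) atTop (𝓝[>] 0) := by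
    refine tendsto_nhdsWithin_iff.2 ⟨?_, Eventually.of_forall fun n => Real.sqrt_pos.2 (hrpos n)⟩
    simpa using hr0.sqrt
  refine ⟨fun n => (√(r n))⁻¹, fun n => inv_pos.2 (Real.sqrt_pos.2 (hrpos n)),
    tendsto_inv_nhdsGT_zero.comp hsq, ?_⟩
  -- With `w n = r n - r (n + 1)` for the tails `r`, this is `(√(r n) - √(r (n + 1)))² ≥ 0`, and the
  -- right side telescopes.
  have hbound : ∀ n, (√(r n))⁻¹ * w n ≤ 2 * √(r n) - 2 * √(r (n + 1)) := by
    intro n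
    have h0 := Real.sqrt_pos.2 (hrpos n)
    have h1 := Real.sqrt_pos.2 (hrpos (n + 1))
    have e0 := Real.sq_sqrt (hrpos n).le
    have e1 := Real.sq_sqrt (hrpos (n + 1)).le
    rw [inv_mul_le_iff₀ h0]
    nlinarith [hrec n, sq_nonneg (√(r n) - √(r (n + 1)))]
  refine summable_of_sum_range_le (c := 2 * √(r 0))
    (fun n => mul_nonneg (inv_nonneg.2 (Real.sqrt_nonneg _)) (hw n).le) fun n => ?_
  calc _ ≤ ∑ i ∈ Finset.range n, (2 * √(r i) - 2 * √(r (i + 1))) :=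
        Finset.sum_le_sum fun i _ => hbound i
    _ = 2 * √(r 0) - 2 * √(r n) := Finset.sum_range_sub' (fun i => 2 * √(r i)) n
    _ ≤ 2 * √(r 0) := by linarith [Real.sqrt_nonneg (r n)]

/-! ### Cluster points in weak topologies, and (ii) ⇔ (iii). -/

/-- Zero is a cluster point in a weak topology iff this can be seen on finitely many test
vectors. -/
theorem mapClusterPt_zero_weakBilin_iff {α X Y : Type*} [AddCommGroup X] [Module ℝ X]
    [AddCommGroup Y] [Module ℝ Y] (B : X →ₗ[ℝ] Y →ₗ[ℝ] ℝ) {l : Filter α} {u : α → WeakBilin B} :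
    MapClusterPt (0 : WeakBilin B) l u ↔
      ∀ s : Finset Y, ∀ ε > 0, ∃ᶠ n in l, ∀ y ∈ s, |B (u n) y| < ε := by
  rw [mapClusterPt_iff_frequently]
  constructor
  · intro h s ε hε
    refine h {x : WeakBilin B | ∀ y ∈ s, |B x y| < ε} ?_
    refine IsOpen.mem_nhds ?_ fun y _ => ?_
    swap
    · change |B 0 y| < ε
      simpa using hε
    simp only [Set.ofPred_forall]
    exact isOpen_biInter_finset fun y _ =>
      isOpen_lt (WeakBilin.eval_continuous B y).abs continuous_const
  · intro h t ht
    obtain ⟨U, hU, hUt⟩ := (B.hasBasis_weakBilin.mem_iff).1 ht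
    obtain ⟨s, ε, hε, rfl⟩ := (B.toSeminormFamily.basisSets_iff).1 hU
    refine (h s ε hε).mono fun n hn => hUt ?_
    refine (Seminorm.mem_ball_zero _).2 ?_
    exact Seminorm.finset_sup_apply_lt hε hn

theorem tendsto_sum_inv_atTop_iff {a : ℕ → ℝ} (ha : ∀ n, 0 < a n) :
    Tendsto (fun N : ℕ => ∑ n ∈ Finset.range N, (a n)⁻¹) atTop atTop ↔
      ¬ Summable fun n => (a n)⁻¹ :=
  (not_summable_iff_tendsto_nat_atTop_of_nonneg fun n => (inv_pos.2 (ha n)).le).symm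

theorem ellPairing_smul_ellBasis (r : ℝ) (n : ℕ) (y : EllOne) :
    ellPairing (r • ellBasis n) y = r * y n := by
  rw [map_smul, LinearMap.smul_apply, smul_eq_mul]
  congr 1
  change ∑' k, ellBasis n k * y k = y n
  rw [tsum_eq_single n]
  · simp [ellBasis]
  · intro k hk
    simp [ellBasis, lp.single_apply, hk]

/-- If `(a n)⁻¹` is summable, it is itself an `ℓ_1` test vector pairing to `1` with every `a n •
ellBasis n`. Conversely, if a neighbourhood given by `s` and `ε` is eventually missed, then `(a n)⁻¹
≤ ε⁻¹ * ∑ y ∈ s, |y n|` eventually, which is summable. -/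
theorem mapClusterPt_ellBasis_iff {a : ℕ → ℝ} (ha : ∀ n, 0 < a n) :
    MapClusterPt (0 : EllInftyWeak) atTop (fun n => toEllInftyWeak (a n • ellBasis n)) ↔
      ¬ Summable fun n => (a n)⁻¹ := by
  have hB : ∀ n (y : EllOne),
      ellPairing (toEllInftyWeak (a n • ellBasis n)) y = a n * y n :=
    fun n y => ellPairing_smul_ellBasis (a n) n y
  have habs : ∀ y : EllOne, Summable fun n => |y n| := fun y => by
    simpa using (lp.memℓp y).summable (by norm_num)
  rw [mapClusterPt_zero_weakBilin_iff]
  constructor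
  · intro h hs
    let y : EllOne := ⟨fun n => (a n)⁻¹, memℓp_gen (by simpa using hs.abs)⟩
    obtain ⟨n, hn⟩ := (h {y} 1 one_pos).exists
    have h1 := hn y (Finset.mem_singleton_self y)
    rw [hB] at h1
    have h2 : a n * y n = 1 := mul_inv_cancel₀ (ha n).ne'
    simp [h2] at h1
  · intro h s ε hε hn
    apply h
    rw [Filter.not_frequently.symm.trans Filter.not_frequently] at hn
    have hsum : Summable fun n => ε⁻¹ * ∑ y ∈ s, |y n| :=
      (summable_sum fun y _ => habs y).mul_left _
    refine hsum.of_norm_bounded_eventually_nat ?_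
    filter_upwards [hn] with n hn
    push Not at hn
    obtain ⟨y, hy, hyn⟩ := hn
    rw [hB, abs_mul, abs_of_pos (ha n)] at hyn
    rw [Real.norm_of_nonneg (inv_pos.2 (ha n)).le]
    have h1 : |y n| ≤ ∑ y ∈ s, |y n| :=
      Finset.single_le_sum (f := fun y : EllOne => |y n|) (fun _ _ => abs_nonneg _) hy
    have h2 := ha n
    rw [inv_le_iff_one_le_mul₀ (ha n), inv_mul_eq_div, div_mul_eq_mul_div, le_div_iff₀ hε]
    nlinarith

/-! ### Complexification, and (i) ⇒ (iii). -/

/-- The extension of a real functional on `E` to the complexification of `E`, realized as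
`E × E`. -/
noncomputable def complexifiedFunctional {E : Type*} [NormedAddCommGroup E] [NormedSpace ℝ E]
    (f : StrongDual ℝ E) : E × E →L[ℝ] ℂ :=
  Complex.ofRealCLM.comp (f.comp (ContinuousLinearMap.fst ℝ E E)) +
    Complex.I • Complex.ofRealCLM.comp (f.comp (ContinuousLinearMap.snd ℝ E E))

theorem complexifiedFunctional_apply {E : Type*} [NormedAddCommGroup E] [NormedSpace ℝ E]
    (f : StrongDual ℝ E) (z : E × E) :
    complexifiedFunctional f z = f z.1 + Complex.I * f z.2 := rfl

theorem complexifiedFunctional_re_im {E : Type*} [NormedAddCommGroup E] [NormedSpace ℝ E]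
    (f : StrongDual ℝ E) (p : E) (ζ : ℂ) :
    complexifiedFunctional f (ζ.re • p, ζ.im • p) = ζ * (f p : ℝ) := by
  rw [complexifiedFunctional_apply]
  simp only [map_smul, smul_eq_mul]
  push_cast
  conv_rhs => rw [← Complex.re_add_im ζ]
  ring

/-- Functionals whose reciprocal norms are summable are jointly bounded away from zero on a pair of
vectors. -/
theorem exists_pair_forall_le_abs_add_abs {E : Type*} [NormedAddCommGroup E] [NormedSpace ℝ E]
    [CompleteSpace E] (f : ℕ → StrongDual ℝ E) (hf : ∀ n, 0 < ‖f n‖)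
    (hs : Summable fun n => ‖f n‖⁻¹) :
    ∃ x y : E, ∃ δ > 0, ∀ n, δ ≤ |f n x| + |f n y| := by
  -- The factor `b n → ∞` forces `‖p n‖ ≤ 2 / b n → 0` below, while the weights `v n` remain
  -- summable.
  obtain ⟨b, hb, hbtop, hbs⟩ := hs.exists_tendsto_atTop_mul fun n => inv_pos.2 (hf n)
  have hu : ∀ n, ∃ u : E, ‖u‖ ≤ 2 / ‖f n‖ ∧ f n u = 1 := by
    intro n
    obtain ⟨x, hx1, hx⟩ := (f n).exists_lt_apply_of_lt_opNorm (half_lt_self (hf n))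
    have h0 : 0 < ‖f n x‖ := (half_pos (hf n)).trans hx
    refine ⟨(f n x)⁻¹ • x, ?_, by simp [norm_pos_iff.1 h0]⟩
    rw [norm_smul, norm_inv, inv_mul_le_iff₀ h0, ← div_le_iff₀ (div_pos two_pos (hf n))]
    have := mul_le_of_le_one_left (hf n).le hx1.le
    rw [div_div_eq_mul_div]
    linarith
  choose u hu1 hu2 using hu
  set v : ℕ → ℝ := fun n => b n * ‖f n‖⁻¹ with hvdef
  have hv : ∀ n, 0 < v n := fun n => mul_pos (hb n) (inv_pos.2 (hf n))
  set p : ℕ → E := fun n => (v n)⁻¹ • u n with hp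
  have hp0 : Tendsto p atTop (𝓝 0) := by
    have hlim : Tendsto (fun n => 2 * (b n)⁻¹) atTop (𝓝 0) := by
      simpa using (tendsto_inv_atTop_zero.comp hbtop).const_mul 2
    refine squeeze_zero_norm (fun n => ?_) hlim
    rw [hp, norm_smul, Real.norm_of_nonneg (inv_nonneg.2 (hv n).le)]
    calc (v n)⁻¹ * ‖u n‖ ≤ (v n)⁻¹ * (2 / ‖f n‖) :=
          mul_le_mul_of_nonneg_left (hu1 n) (inv_nonneg.2 (hv n).le)
      _ = 2 * (b n)⁻¹ := by
          have := (hb n).ne'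
          have := (hf n).ne'
          simp only [hvdef]
          field_simp
  -- Complex multiplication `ζ • p` for a real vector `p`, written in `E × E`.
  set Φ : ℂ × E → E × E := fun q => (q.1.re • q.2, q.1.im • q.2) with hΦ
  have hΦc : Continuous Φ := by
    have h1 := Complex.continuous_re
    have h2 := Complex.continuous_im
    fun_prop
  set S : Set (E × E) := Φ '' (Metric.closedBall (0 : ℂ) 1 ×ˢ insert 0 (Set.range p)) with hS
  have hScomp : IsCompact S :=
    ((isCompact_closedBall 0 1).prod hp0.isCompact_insert_range).image hΦc
  have hR : ∀ k (ζ : ℂ), ‖ζ‖ = 1 → Φ (ζ, p k) ∈ closedAbsConvexHull ℝ S := by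
    intro k ζ hζ
    refine subset_closedAbsConvexHull (Set.mem_image_of_mem _ ⟨?_, ?_⟩)
    · simp [hζ]
    · exact Set.mem_insert_of_mem _ (Set.mem_range_self k)
  obtain ⟨z, -, hz⟩ := exists_forall_exp_neg_le_norm
    (absConvex_convexClosedHull (𝕜 := ℝ) (s := S)).2
    (isCompact_closedAbsConvexHull_of_totallyBounded hScomp.totallyBounded)
    ⟨_, hR 0 1 (by simp)⟩ (fun n => complexifiedFunctional (f n)) (fun k ζ => Φ (ζ, p k))
    (fun j k => (f j (p k) : ℝ)) v hv hbs hR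
    (fun j k ζ => complexifiedFunctional_re_im (f j) (p k) ζ)
    (fun k => by simp [hp, hu2])
  refine ⟨z.1, z.2, Real.exp (-∑' k, v k) / 2, by positivity, fun n => (hz n).trans ?_⟩
  rw [complexifiedFunctional_apply]
  refine (norm_add_le _ _).trans ?_
  simp

theorem mapClusterPt_zero_weakDual_iff {α E : Type*} [NormedAddCommGroup E] [NormedSpace ℝ E]
    {l : Filter α} {x : α → StrongDual ℝ E} :
    MapClusterPt (0 : WeakDual ℝ E) l (fun n => StrongDual.toWeakDual (x n)) ↔
      ∀ s : Finset E, ∀ ε > 0, ∃ᶠ n in l, ∀ y ∈ s, |x n y| < ε :=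
  mapClusterPt_zero_weakBilin_iff (topDualPairing ℝ E)

theorem WeakStarAcceptable.not_summable_inv {E : Type*} [NormedAddCommGroup E] [NormedSpace ℝ E]
    [CompleteSpace E] {a : ℕ → ℝ} (ha : ∀ n, 0 < a n) (h : WeakStarAcceptable E a) :
    ¬ Summable fun n => (a n)⁻¹ := by
  classical
  obtain ⟨f, hf, hcl⟩ := h
  intro hs
  obtain ⟨x, y, δ, hδ, hxy⟩ := exists_pair_forall_le_abs_add_abs f
    (fun n => by rw [hf]; exact ha n) (by simpa only [hf] using hs)
  obtain ⟨n, hn⟩ := ((mapClusterPt_zero_weakDual_iff.1 hcl) {x, y} (δ / 2) (half_pos hδ)).exists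
  have h1 := hn x (by simp)
  have h2 := hn y (by simp)
  linarith [hxy n]

/-! ### Copies of the unit vectors in the dual, and (iii) ⇒ (i). -/

theorem norm_sum_smul_ellBasis_le {s : Finset ℕ} {σ : ℕ → ℝ} (hσ : ∀ n, |σ n| ≤ 1) :
    ‖∑ n ∈ s, σ n • ellBasis n‖ ≤ 1 := by
  refine lp.norm_le_of_forall_le zero_le_one fun k => ?_
  have : (∑ n ∈ s, σ n • ellBasis n : EllInfty) k = if k ∈ s then σ k else 0 := by
    rw [lp.coeFn_sum, Finset.sum_apply]
    simp [ellBasis, lp.single_apply, Pi.single_apply]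
  rw [this]
  split_ifs
  · exact hσ k
  · simp

theorem norm_ellBasis (n : ℕ) : ‖ellBasis n‖ = 1 := by
  simp [ellBasis]

/-- If `ℓ_∞` is finitely representable in `E*`, then `E*` contains unit vectors
`w_0, …, w_{M-1}` with `∑ |w_n x| ≤ 2 ‖x‖` for all `x`. -/
theorem FinitelyRepresentable.exists_norm_eq_one_sum_le {E : Type*} [NormedAddCommGroup E]
    [NormedSpace ℝ E] (hE : FinitelyRepresentable EllInfty (StrongDual ℝ E)) (M : ℕ) :
    ∃ w : ℕ → StrongDual ℝ E, (∀ n < M, ‖w n‖ = 1) ∧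
      ∀ x, ∑ n ∈ Finset.range M, |w n x| ≤ 2 * ‖x‖ := by
  obtain ⟨T, hT⟩ := hE (Submodule.span ℝ (ellBasis '' (Finset.range M : Set ℕ)))
    (FiniteDimensional.span_of_finite ℝ ((Finset.range M).finite_toSet.image _)) 1 one_pos
  have hmem : ∀ n : ℕ, n < M →
      ellBasis n ∈ Submodule.span ℝ (ellBasis '' (Finset.range M : Set ℕ)) := fun n hn =>
    Submodule.subset_span (Set.mem_image_of_mem _ (by simpa using hn))
  set e : ℕ → Submodule.span ℝ (ellBasis '' (Finset.range M : Set ℕ)) := fun n =>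
    if h : n < M then ⟨ellBasis n, hmem n h⟩ else 0 with he
  have hecoe : ∀ n < M, (e n : EllInfty) = ellBasis n := fun n hn => by simp [he, hn]
  have hT1 : ∀ n < M, 1 ≤ ‖T (e n)‖ := fun n hn => by
    have := (hT (e n)).1
    rwa [Submodule.coe_norm, hecoe n hn, norm_ellBasis] at this
  refine ⟨fun n => ‖T (e n)‖⁻¹ • T (e n), fun n hn => ?_, fun x => ?_⟩
  · rw [norm_smul, norm_inv, norm_norm, inv_mul_cancel₀ (by linarith [hT1 n hn])]
  -- The signs turn the sum of absolute values at `x` into one functional `T (∑ σ n • e n)`, of norm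
  -- at most `1 + 1 = 2`.
  set σ : ℕ → ℝ := fun n => SignType.sign (T (e n) x) with hσ
  have hσ1 : ∀ n, |σ n| ≤ 1 := fun n => by
    rcases lt_trichotomy (T (e n) x) 0 with h | h | h <;> simp [hσ, h]
  have hnorm : ‖∑ n ∈ Finset.range M, σ n • e n‖ ≤ 1 := by
    rw [Submodule.coe_norm, Submodule.coe_sum]
    rw [Finset.sum_congr rfl fun n hn => by
      rw [Submodule.coe_smul, hecoe n (Finset.mem_range.1 hn)]]
    exact norm_sum_smul_ellBasis_le hσ1
  calc ∑ n ∈ Finset.range M, |(‖T (e n)‖⁻¹ • T (e n)) x|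
      ≤ ∑ n ∈ Finset.range M, σ n * T (e n) x := by
        refine Finset.sum_le_sum fun n hn => ?_
        have h1 := hT1 n (Finset.mem_range.1 hn)
        rw [smul_apply, smul_eq_mul, abs_mul, abs_of_nonneg (by positivity),
          hσ, sign_mul_self]
        exact mul_le_of_le_one_left (abs_nonneg _) (inv_le_one_of_one_le₀ h1)
    _ = T (∑ n ∈ Finset.range M, σ n • e n) x := by
        simp [map_sum]
    _ ≤ ‖T (∑ n ∈ Finset.range M, σ n • e n)‖ * ‖x‖ :=
        (le_abs_self _).trans ((T _).le_opNorm x)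
    _ ≤ 2 * ‖x‖ := by
        refine mul_le_mul_of_nonneg_right ?_ (norm_nonneg x)
        linarith [(hT (∑ n ∈ Finset.range M, σ n • e n)).2]

/-- The indices are cut into blocks `[N k, N (k + 1))` with `∑ (a n)⁻¹ ≥ k`, and block `k` uses the
vectors `w` of the family of length `N (k + 1)`. If the neighbourhood given by `s` and `ε` were
missed throughout block `k`, then `ε * (a n)⁻¹ ≤ ∑ x ∈ s, |w n x|` there; summing over the block
gives `ε * k ≤ ∑ x ∈ s, 2 * ‖x‖`, which is false for large `k`. -/
theorem FinitelyRepresentable.weakStarAcceptable {E : Type*} [NormedAddCommGroup E]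
    [NormedSpace ℝ E] (hE : FinitelyRepresentable EllInfty (StrongDual ℝ E))
    {a : ℕ → ℝ} (ha : ∀ n, 0 < a n)
    (h : Tendsto (fun N : ℕ => ∑ n ∈ Finset.range N, (a n)⁻¹) atTop atTop) :
    WeakStarAcceptable E a := by
  choose w hw1 hw2 using hE.exists_norm_eq_one_sum_le
  have hstep : ∀ m k : ℕ, ∃ m' > m, (k : ℝ) ≤ ∑ n ∈ Finset.Ico m m', (a n)⁻¹ := by
    intro m k
    obtain ⟨m', hm', hk⟩ := ((eventually_gt_atTop m).and
      (h.eventually_ge_atTop (k + ∑ n ∈ Finset.range m, (a n)⁻¹))).exists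
    refine ⟨m', hm', ?_⟩
    rw [Finset.sum_Ico_eq_sub _ hm'.le]
    linarith
  choose next hnext hsum using hstep
  set N : ℕ → ℕ := fun k => Nat.rec 0 (fun k m => next m k) k with hN
  have hNs : ∀ k, N (k + 1) = next (N k) k := fun k => rfl
  have hmono : StrictMono N := strictMono_nat_of_lt_succ fun k => hnext (N k) k
  have hex : ∀ n, ∃ k, n < N (k + 1) := fun n => ⟨n, hmono.le_apply.trans_lt' (Nat.lt_succ_self n)⟩
  -- The number of the block that contains `n`.
  set κ : ℕ → ℕ := fun n => Nat.find (hex n) with hκ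
  have hκlt : ∀ n, n < N (κ n + 1) := fun n => Nat.find_spec (hex n)
  have hκeq : ∀ k n, N k ≤ n → n < N (k + 1) → κ n = k := by
    intro k n h1 h2
    refine (Nat.find_eq_iff _).2 ⟨h2, fun j hj hlt => ?_⟩
    have := hmono.monotone (Nat.succ_le_of_lt hj)
    exact absurd (hlt.trans_le (this.trans h1)) (lt_irrefl _)
  refine ⟨fun n => a n • w (N (κ n + 1)) n, fun n => ?_, ?_⟩
  · rw [norm_smul, hw1 _ n (hκlt n), mul_one, Real.norm_of_nonneg (ha n).le]
  rw [mapClusterPt_zero_weakDual_iff]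
  intro s ε hε
  rw [frequently_atTop]
  intro n₀
  by_contra! hcon
  obtain ⟨k, hk1, hk2⟩ : ∃ k : ℕ, n₀ ≤ k ∧ ∑ x ∈ s, 2 * ‖x‖ < ε * k := by
    obtain ⟨k, hk⟩ := exists_nat_gt ((∑ x ∈ s, 2 * ‖x‖) / ε)
    refine ⟨max n₀ k, le_max_left _ _, ?_⟩
    rw [div_lt_iff₀' hε] at hk
    refine hk.trans_le (mul_le_mul_of_nonneg_left ?_ hε.le)
    exact_mod_cast le_max_right _ _
  have hterm : ∀ n ∈ Finset.Ico (N k) (N (k + 1)),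
      ε * (a n)⁻¹ ≤ ∑ x ∈ s, |w (N (k + 1)) n x| := by
    intro n hn
    rw [Finset.mem_Ico] at hn
    obtain ⟨x, hx, hxn⟩ := hcon n (hk1.trans (hmono.le_apply.trans hn.1))
    rw [hκeq k n hn.1 hn.2, smul_apply, smul_eq_mul, abs_mul,
      abs_of_pos (ha n)] at hxn
    refine le_trans ?_ (Finset.single_le_sum (f := fun x => |w (N (k + 1)) n x|)
      (fun _ _ => abs_nonneg _) hx)
    rwa [← div_eq_mul_inv, div_le_iff₀' (ha n)]
  have h1 : ε * k ≤ ε * ∑ n ∈ Finset.Ico (N k) (N (k + 1)), (a n)⁻¹ :=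
    mul_le_mul_of_nonneg_left (hsum (N k) k) hε.le
  have h2 : ∑ n ∈ Finset.Ico (N k) (N (k + 1)), ∑ x ∈ s, |w (N (k + 1)) n x|
      ≤ ∑ x ∈ s, 2 * ‖x‖ := by
    rw [Finset.sum_comm]
    refine Finset.sum_le_sum fun x _ => (Finset.sum_le_sum_of_subset_of_nonneg ?_
      fun _ _ _ => abs_nonneg _).trans (hw2 (N (k + 1)) x)
    intro n hn
    exact Finset.mem_range.2 (Finset.mem_Ico.1 hn).2
  rw [Finset.mul_sum] at h1
  linarith [Finset.sum_le_sum hterm]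

theorem mainTheorem8 (E : Type*) [NormedAddCommGroup E] [NormedSpace ℝ E] [CompleteSpace E]
    (hE : FinitelyRepresentable EllInfty (StrongDual ℝ E))
    (a : ℕ → ℝ) (ha : ∀ n, 0 < a n) :
    List.TFAE [
      WeakStarAcceptable E a,
      MapClusterPt (0 : EllInftyWeak) atTop (fun n => toEllInftyWeak (a n • ellBasis n)),
      Tendsto (fun N : ℕ => ∑ n ∈ Finset.range N, (a n)⁻¹) atTop atTop] := by
  tfae_have 2 ↔ 3 := (mapClusterPt_ellBasis_iff ha).trans (tendsto_sum_inv_atTop_iff ha).symm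
  tfae_have 1 → 3 := fun h => (tendsto_sum_inv_atTop_iff ha).2 (h.not_summable_inv ha)
  tfae_have 3 → 1 := hE.weakStarAcceptable ha
  tfae_finish
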